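/- Let $G$ be a finite group and $\alpha=(D_g,\alpha_g)_{g\in G}$ a unital partial action of $G$ on a commutative ring $R$: each $D_g=R1_g$ is the ideal generated by an idempotent $1_g$, each $\alpha_g\colon D_{g^{-1}}\to D_g$ is a ring isomorphism, $D_1=R$, $\alpha_1=\mathrm{id}_R$, $\alpha_g(D_{g^{-1}}D_h)=D_gD_{gh}$, and $\alpha_g\circ\alpha_h=\alpha_{gh}$ on $D_{h^{-1}}D_{(gh)^{-1}}$. Assume that $R$ is an $\alpha$-partial Galois extension of $R^\alpha=\{r\in R: \alpha_g(r1_{g^{-1}})=r1_g\ \forall g\in G\}$, i.e. there are $x_1,\dots,x_m,y_1,\dots,y_m\in R$ with $\sum_i x_i\alpha_g(y_i1_{g^{-1}})=\delta_{1,g}$ for all $g\in G$. For $n=1,2$ let $C^n(G,\alpha,R)$ be the group of functions $f\colon G^n\to R$ such that $f(g)$ is a unit of the ring $D_g$ (for $n=1$), respectively $f(g,h)$ is a unit of the ring $D_gD_{gh}$ (for $n=2$). Let $$Z^2=\{\omega\in C^2(G,\alpha,R): \alpha_g(\omega_{h,l}1_{g^{-1}})\,\omega_{g,hl}=\omega_{gh,l}\,\omega_{g,h}\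 \ \forall g,h,l\in G\},$$ let $B^2$ be the group of all $(g,h)\mapsto \alpha_g(f(h)1_{g^{-1}})f(g)f(gh)^{-1}$ with $f\in C^1(G,\alpha,R)$ (the inverse being taken in $D_{gh}$), and $H^2(G,\alpha,R)=Z^2/B^2$, with $\mathrm{cls}(\omega)$ the class of $\omega$. For an $R$-module $M$ on which $1_{g^{-1}}$ acts as the identity, let $M_g$ be the $R$-module with underlying group $M$ and action $r\bullet x=\alpha_{g^{-1}}(r1_g)x$. Let $\mathbf{PicS}(R)$ be the set of isomorphism classes of finitely generated projective $R$-modules $E$ that admit an $R$-algebra epimorphism $R^{\mathrm{op}}\to\mathrm{End}_R(E)$, and let $\mathbf{PicS}(R)^{\alpha^*}$ be the set of those $[E]$ with $(D_{g^{-1}}\otimes_R E)_g\cong D_g\otimes_R E$ as $R$-modules for all $g\in G$. Then $\mathbf{PicS}(R)^{\alpha^*}\cap\mathbf{Pic}(R)$ is a subgroup of $\mathbf{Pic}(R)$, and the following hold. (1) For every $[E]\in\mathbf{PicS}(R)^{\alpha^*}\cap\mathbf{Pic}(R)$ there is a family of $R$-module isomorphisms $\psi_g\colon ED_g\to(ED_{g^{-1}})_g$,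 $g\in G$. For every such family, all compositions $\psi_{(gh)^{-1}}\psi_{h^{-1}}^{-1}\psi_{g^{-1}}^{-1}$ are defined on $ED_gD_{gh}$, and there is a unique $\omega\in C^2(G,\alpha,R)$ with $$\psi_{(gh)^{-1}}\psi_{h^{-1}}^{-1}\psi_{g^{-1}}^{-1}(x)=\omega_{g,h}\,x\qquad\text{for all } g,h\in G,\ x\in ED_gD_{gh};$$ moreover $\omega\in Z^2$. (2) The class $\mathrm{cls}(\omega)\in H^2(G,\alpha,R)$ depends neither on the choice of the isomorphisms $\psi_g$ nor on the choice of the representative $E$ of $[E]$. (3) The resulting well-defined map $\varphi_3\colon \mathbf{PicS}(R)^{\alpha^*}\cap\mathbf{Pic}(R)\to H^2(G,\alpha,R)$, $[E]\mapsto\mathrm{cls}(\omega)$, is a group homomorphism. -/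

import Mathlib

open scoped TensorProduct

universe u v

/-- The element `r·e` of the ring `Re`, for an idempotent `e` of a commutative ring `R`
(Mathlib's `he.Corner` is the ring `eRe = Re` with identity element `e`). -/
def IsIdempotentElem.toCorner {R : Type u} [CommRing R] {e : R} (he : IsIdempotentElem e) (r : R) :
    he.Corner :=
  ⟨r * e, ⟨r, by dsimp only; rw [mul_comm e r, mul_assoc, he.eq]⟩⟩

/-- A unital (non twisted) partial action of a group `G` on a commutative ring `R`: idempotents
`1_g` (here `e g`), the ideals `D_g = R·1_g` (as rings: `(idem g).Corner`), and ring isomorphisms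
`α_g : D_{g⁻¹} → D_g` (here `act g`) such that `D_1 = R` and `α_1 = id`,
`α_g(D_{g⁻¹} D_h) = D_g D_{gh}`, and `α_g ∘ α_h = α_{gh}` on `D_{h⁻¹} D_{(gh)⁻¹}`. -/
structure UnitalPartialAction (G : Type v) (R : Type u) [Group G] [CommRing R] where
  e : G → R
  idem : ∀ g, IsIdempotentElem (e g)
  act : ∀ g, (idem g⁻¹).Corner ≃+* (idem g).Corner
  e_one : e 1 = 1
  act_one : ∀ t : (idem 1⁻¹).Corner, (act 1 t).1 = t.1
  image_act : ∀ g h,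
    (fun t : (idem g⁻¹).Corner => (act g t).1) '' {t | t.1 ∈ Ideal.span {e g⁻¹} * Ideal.span {e h}}
      = ((Ideal.span {e g} * Ideal.span {e (g * h)} : Ideal R) : Set R)
  act_act : ∀ g h (t : R), t ∈ Ideal.span {e h⁻¹} * Ideal.span {e (g * h)⁻¹} →
    (act g ((idem g⁻¹).toCorner (act h ((idem h⁻¹).toCorner t)).1)).1
      = (act (g * h) ((idem (g * h)⁻¹).toCorner t)).1

/-- `E` represents a class in `PicS(R)`: it is a finitely generated projective `R`-module with an
epimorphism of `R`-algebras `Rᵒᵖ → End_R(E)`. -/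
def IsPartiallyInvertible (R : Type u) [CommRing R] (E : Type v) [AddCommGroup E] [Module R E] :
    Prop :=
  Module.Finite R E ∧ Module.Projective R E ∧
    ∃ f : Rᵐᵒᵖ →ₐ[R] Module.End R E, Function.Surjective f

namespace UnitalPartialAction

section

variable {G : Type v} {R : Type u} [Group G] [CommRing R] (α : UnitalPartialAction G R)

/-- The ideal `D_g = R·1_g`. -/
def D (g : G) : Ideal R := Ideal.span {α.e g}

/-- The map `r ↦ α_g(r 1_{g⁻¹})` from `R` to `R`. -/
def app (g : G) (r : R) : R := (α.act g ((α.idem g⁻¹).toCorner r)).1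

/-- `R` is an `α`-partial Galois extension of `R^α`: there are finitely many `x_i, y_i` in `R` with
`∑ x_i α_g(y_i 1_{g⁻¹}) = δ_{1,g}` for all `g`. -/
def IsPartialGalois : Prop :=
  ∃ (m : ℕ) (x y : Fin m → R),
    ∑ i, x i * α.app 1 (y i) = 1 ∧ ∀ g : G, g ≠ 1 → ∑ i, x i * α.app g (y i) = 0

/-! ### Elementary facts on `app` -/

theorem e_mul_e (g : G) : α.e g * α.e g = α.e g := (α.idem g).eq

theorem corner_mul_e {e : R} (he : IsIdempotentElem e) (t : he.Corner) : t.1 * e = t.1 :=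
  ((Subsemigroup.mem_corner_iff he).mp t.2).2

theorem toCorner_coe {e : R} (he : IsIdempotentElem e) (t : he.Corner) : he.toCorner t.1 = t :=
  Subtype.ext (corner_mul_e he t)

theorem app_coe (g : G) (t : (α.idem g⁻¹).Corner) : α.app g t.1 = (α.act g t).1 := by
  rw [app, toCorner_coe]

theorem app_add (g : G) (r s : R) : α.app g (r + s) = α.app g r + α.app g s := by
  have : (α.idem g⁻¹).toCorner (r + s) = (α.idem g⁻¹).toCorner r + (α.idem g⁻¹).toCorner s :=
    Subtype.ext (add_mul _ _ _)
  rw [app, this, map_add]; rfl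

theorem app_mul (g : G) (r s : R) : α.app g (r * s) = α.app g r * α.app g s := by
  have : (α.idem g⁻¹).toCorner (r * s) = (α.idem g⁻¹).toCorner r * (α.idem g⁻¹).toCorner s := by
    refine Subtype.ext ?_
    change r * s * α.e g⁻¹ = (r * α.e g⁻¹) * (s * α.e g⁻¹)
    linear_combination (-(r * s)) * α.e_mul_e g⁻¹
  rw [app, this, map_mul]; rfl

theorem app_zero (g : G) : α.app g 0 = 0 := by
  have : (α.idem g⁻¹).toCorner 0 = 0 := Subtype.ext (zero_mul _)
  rw [app, this, map_zero]; rfl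

theorem app_one (g : G) : α.app g 1 = α.e g := by
  have : (α.idem g⁻¹).toCorner 1 = 1 := Subtype.ext (one_mul _)
  rw [app, this, map_one]; rfl

theorem app_mul_e (g : G) (r : R) : α.app g r * α.e g = α.app g r := corner_mul_e (α.idem g) _

theorem mem_mul_iff {a b : R} (ha : IsIdempotentElem a) (hb : IsIdempotentElem b) (r : R) :
    r ∈ Ideal.span {a} * Ideal.span {b} ↔ r * (a * b) = r := by
  rw [Ideal.span_singleton_mul_span_singleton, Ideal.mem_span_singleton']
  refine ⟨?_, fun h => ⟨r, h⟩⟩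
  rintro ⟨s, rfl⟩
  rw [mul_assoc, (ha.mul hb).eq]

/-- `α_g(1_h 1_{g⁻¹}) = 1_g 1_{gh}`. -/
theorem app_e (g h : G) : α.app g (α.e h) = α.e g * α.e (g * h) := by
  have h1 : α.app g (α.e h) ∈
      ((Ideal.span {α.e g} * Ideal.span {α.e (g * h)} : Ideal R) : Set R) := by
    rw [← α.image_act g h]
    refine ⟨(α.idem g⁻¹).toCorner (α.e h), ?_, rfl⟩
    refine (mem_mul_iff (α.idem _) (α.idem _) _).2 ?_
    change α.e h * α.e g⁻¹ * (α.e g⁻¹ * α.e h) = α.e h * α.e g⁻¹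
    linear_combination (α.e g⁻¹ * α.e g⁻¹) * α.e_mul_e h + α.e h * α.e_mul_e g⁻¹
  have h2 : α.e g * α.e (g * h) ∈
      ((Ideal.span {α.e g} * Ideal.span {α.e (g * h)} : Ideal R) : Set R) :=
    (mem_mul_iff (α.idem _) (α.idem _) _).2 ((α.idem _).mul (α.idem _)).eq
  rw [← α.image_act g h] at h2
  obtain ⟨t, ht, hte⟩ := h2
  replace h1 := (mem_mul_iff (α.idem _) (α.idem _) _).1 h1
  replace ht := (mem_mul_iff (α.idem _) (α.idem _) _).1 ht
  have h3 : t.1 = t.1 * α.e h := by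
    have := corner_mul_e _ t
    linear_combination (α.e h - 1) * ht + t.1 * α.e g⁻¹ * (-1) * α.e_mul_e h
  have h4 : α.app g t.1 = α.e g * α.e (g * h) := (α.app_coe g t).trans hte
  have h5 : α.app g t.1 = α.app g t.1 * α.app g (α.e h) := by
    rw [← app_mul]
    exact congrArg (α.app g) h3
  rw [h4] at h5
  rw [← h1, mul_comm, ← h5]

theorem app_one_left (r : R) : α.app 1 r = r := by
  rw [app, α.act_one]
  change r * α.e 1⁻¹ = r
  rw [inv_one, e_one, mul_one]

/-- `α_g(α_{g⁻¹}(r 1_g)) = r 1_g`. -/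
theorem app_app_inv (g : G) (r : R) : α.app g (α.app g⁻¹ r) = r * α.e g := by
  have h1 : α.app g⁻¹ r = α.app g⁻¹ (r * α.e g) := by
    rw [app_mul, app_e, inv_mul_cancel, e_one, mul_one, app_mul_e]
  have h2 := α.act_act g g⁻¹ (r * α.e g) ((mem_mul_iff (α.idem _) (α.idem _) _).2 (by
    rw [inv_inv, mul_inv_cancel, inv_one, e_one, mul_one, mul_assoc, e_mul_e]))
  change α.app g (α.app g⁻¹ (r * α.e g)) = α.app (g * g⁻¹) (r * α.e g) at h2
  rw [h1, h2, mul_inv_cancel, app_one_left]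

/-! ### Partial cohomology in degree two -/

/-- Partial 1-cochains: functions `f` on `G` with `f(g)` a unit of the ring `D_g = R·1_g`. -/
abbrev C1 : Type (max u v) := ∀ g : G, ((α.idem g).Corner)ˣ

/-- Partial 2-cochains: functions `ω` on `G × G` with `ω(g,h)` a unit of the ring
`D_g D_{gh} = R·1_g 1_{gh}`. -/
abbrev C2 : Type (max u v) := ∀ g h : G, (((α.idem g).mul (α.idem (g * h))).Corner)ˣ

variable {α} in
/-- The value of a 1-cochain as an element of `R`. -/
def C1.val (f : α.C1) (g : G) : R := (f g).1.1

variable {α} in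
/-- The value of a 2-cochain as an element of `R`. -/
def C2.val (w : α.C2) (g h : G) : R := (w g h).1.1

theorem C1.val_mul (f f' : α.C1) (g : G) : (f * f').val g = f.val g * f'.val g := rfl
theorem C1.val_one (g : G) : (1 : α.C1).val g = α.e g := rfl
theorem C2.val_mul (w w' : α.C2) (g h : G) : (w * w').val g h = w.val g h * w'.val g h := rfl
theorem C2.val_one (g h : G) : (1 : α.C2).val g h = α.e g * α.e (g * h) := rfl

theorem C1.val_mul_e (f : α.C1) (g : G) : f.val g * α.e g = f.val g := corner_mul_e _ _
theorem C2.val_mul_e (w : α.C2) (g h : G) : w.val g h * (α.e g * α.e (g * h)) = w.val g h :=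
  corner_mul_e ((α.idem g).mul (α.idem (g * h))) _

theorem C1.val_mul_inv (f : α.C1) (g : G) : f.val g * f⁻¹.val g = α.e g := by
  rw [← C1.val_mul, mul_inv_cancel, C1.val_one]
theorem C2.val_mul_inv (w : α.C2) (g h : G) : w.val g h * w⁻¹.val g h = α.e g * α.e (g * h) := by
  rw [← C2.val_mul, mul_inv_cancel, C2.val_one]

/-- Partial 2-cocycles: `α_g(ω(h,l) 1_{g⁻¹}) ω(g,hl) = ω(gh,l) ω(g,h)`. -/
def Z2 : Subgroup α.C2 where
  carrier := {w | ∀ g h l, α.app g (w.val h l) * w.val g (h * l) = w.val (g * h) l * w.val g h}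
  one_mem' g h l := by
    simp only [C2.val_one, app_mul, app_e, mul_assoc]
    linear_combination (α.e (g * h) * α.e (g * (h * l)) * (α.e (g * (h * l))) * (α.e g + 1)) *
      α.e_mul_e g + α.e g * α.e (g * h) * α.e_mul_e (g * (h * l))
      - α.e g * α.e (g * (h * l)) * α.e_mul_e (g * h)
  mul_mem' {w w'} hw hw' g h l := by
    have h1 := hw g h l
    have h2 := hw' g h l
    simp only [C2.val_mul, app_mul]
    linear_combination (α.app g (w'.val h l) * w'.val g (h * l)) * h1
      + (w.val (g * h) l * w.val g h) * h2
  inv_mem' {w} hw g h l := by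
    have h1 := hw g h l
    have ha : α.app g (w.val h l) * α.app g (w⁻¹.val h l)
        = α.e g * α.e (g * h) * (α.e g * α.e (g * (h * l))) := by
      rw [← app_mul, C2.val_mul_inv, app_mul, app_e, app_e]
    have hb := C2.val_mul_inv α w g (h * l)
    have hc := C2.val_mul_inv α w (g * h) l
    have hd := C2.val_mul_inv α w g h
    have hb' := C2.val_mul_e α w⁻¹ g (h * l)
    have hc' := C2.val_mul_e α w⁻¹ (g * h) l
    have hd' := C2.val_mul_e α w⁻¹ g h
    have ha' : α.app g (w⁻¹.val h l) * (α.e g * α.e (g * h) * (α.e g * α.e (g * (h * l))))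
        = α.app g (w⁻¹.val h l) := by
      rw [← app_e, ← app_e, ← app_mul, ← app_mul, C2.val_mul_e]
    rw [mul_assoc] at hc hc'
    have eg := α.e_mul_e g
    have eh := α.e_mul_e (g * h)
    have el := α.e_mul_e (g * (h * l))
    generalize α.app g (w.val h l) = a at *
    generalize α.app g (w⁻¹.val h l) = a' at *
    generalize w.val g (h * l) = b at *
    generalize w⁻¹.val g (h * l) = b' at *
    generalize w.val (g * h) l = c at *
    generalize w⁻¹.val (g * h) l = c' at *
    generalize w.val g h = d at *
    generalize w⁻¹.val g h = d' at *
    generalize α.e g = x at *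
    generalize α.e (g * h) = y at *
    generalize α.e (g * (h * l)) = z at *
    have s1 : a' * b' = a' * b' * ((c * c') * (d * d')) := by
      rw [hc, hd]
      calc a' * b' = a' * (x * y * (x * z)) * b' := by rw [ha']
        _ = a' * b' * (y * z * (x * y)) := by
          linear_combination (a' * b' * y * z) * eg - (a' * b' * z * x) * eh
    have s2 : c' * d' = c' * d' * ((a * a') * (b * b')) := by
      rw [ha, hb]
      calc c' * d' = c' * (y * z) * (d' * (x * y)) := by rw [hc', hd']
        _ = c' * d' * (x * y * (x * z) * (x * z)) := by
          linear_combination (c' * d' * z * x) * eh - (c' * d' * y * z * z * (x + 1)) * eg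
            - (c' * d' * x * y) * el
    rw [s1, s2]
    linear_combination (-(a' * b' * c' * d')) * h1

/-- Partial 2-coboundaries: `ω(g,h) = α_g(f(h) 1_{g⁻¹}) f(g) f(gh)⁻¹` for a 1-cochain `f`, the
inverse `f(gh)⁻¹` being taken in `D_{gh}`. -/
def B2 : Subgroup α.C2 where
  carrier := {w | ∃ f : α.C1, ∀ g h, w.val g h = α.app g (f.val h) * f.val g * f⁻¹.val (g * h)}
  one_mem' := ⟨1, fun g h => by
    rw [inv_one, C2.val_one, C1.val_one, C1.val_one, C1.val_one, app_e]
    linear_combination (-α.e (g * h) * α.e (g * h)) * α.e_mul_e g - α.e g * α.e_mul_e (g * h)⟩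
  mul_mem' := by
    rintro w w' ⟨f, hf⟩ ⟨f', hf'⟩
    refine ⟨f * f', fun g h => ?_⟩
    have hi : (f * f')⁻¹ = f⁻¹ * f'⁻¹ := mul_inv f f'
    rw [hi, C2.val_mul, C1.val_mul, C1.val_mul, C1.val_mul, app_mul, hf, hf']
    ring
  inv_mem' := by
    rintro w ⟨f, hf⟩
    refine ⟨f⁻¹, fun g h => ?_⟩
    rw [inv_inv]
    have ha : α.app g (f.val h) * α.app g (f⁻¹.val h) = α.e g * α.e (g * h) := by
      rw [← app_mul, C1.val_mul_inv, app_e]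
    have ha' : α.app g (f⁻¹.val h) * (α.e g * α.e (g * h)) = α.app g (f⁻¹.val h) := by
      rw [← app_e, ← app_mul, C1.val_mul_e]
    have hb := C1.val_mul_inv α f g
    have hc := C1.val_mul_inv α f (g * h)
    have hd := C2.val_mul_inv α w g h
    have hd' := C2.val_mul_e α w⁻¹ g h
    have eg := α.e_mul_e g
    have eh := α.e_mul_e (g * h)
    rw [hf] at hd
    generalize α.app g (f.val h) = a at *
    generalize α.app g (f⁻¹.val h) = a' at *
    generalize f.val g = b at *
    generalize f⁻¹.val g = b' at *
    generalize f.val (g * h) = c at *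
    generalize f⁻¹.val (g * h) = c' at *
    generalize w⁻¹.val g h = d' at *
    generalize α.e g = x at *
    generalize α.e (g * h) = y at *
    have s1 : d' = d' * ((a * a') * (b * b') * (c * c')) := by
      rw [ha, hb, hc]
      linear_combination (-1) * hd' - (d' * y * y) * eg - d' * x * eh
    rw [s1]
    calc d' * ((a * a') * (b * b') * (c * c')) = (a * b * c' * d') * (a' * b' * c) := by ring
      _ = (a' * (x * y)) * b' * c := by rw [hd]; ring
      _ = _ := by rw [ha']

/-- The second partial cohomology group `H²(G, α, R) = Z²/B²`. -/
abbrev H2 : Type (max u v) := α.Z2 ⧸ (α.B2.subgroupOf α.Z2)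

variable {α} in
/-- The cohomology class of a partial 2-cocycle. -/
def cls (w : α.Z2) : α.H2 := QuotientGroup.mk w

/-! ### Twisted modules and the invariant part of the Picard group -/

/-- For an `R`-module `M` with `1_{g⁻¹} x = x` for all `x`, the `R`-module `M_g`: the set `M` with
the action `r • x = α_{g⁻¹}(r 1_g) x`. -/
def Twist (g : G) (M : Type*) [AddCommGroup M] [Module R M] (_ : ∀ x : M, α.e g⁻¹ • x = x) :
    Type _ := M

section Twist

variable {α} {g : G} {M : Type*} [AddCommGroup M] [Module R M] {hM : ∀ x : M, α.e g⁻¹ • x = x}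

instance : AddCommGroup (α.Twist g M hM) := inferInstanceAs (AddCommGroup M)

/-- The identity map `M_g → M`. -/
def Twist.val : α.Twist g M hM ≃+ M := AddEquiv.refl M

instance : Module R (α.Twist g M hM) where
  smul r x := Twist.val.symm (α.app g⁻¹ r • Twist.val x)
  one_smul x := by
    change α.app g⁻¹ 1 • Twist.val x = Twist.val x
    rw [app_one, hM]
  mul_smul r s x := by
    change α.app g⁻¹ (r * s) • Twist.val x = α.app g⁻¹ r • α.app g⁻¹ s • Twist.val x
    rw [app_mul, mul_smul]
  smul_zero r := smul_zero (A := M) (α.app g⁻¹ r)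
  smul_add r x y := smul_add (A := M) (α.app g⁻¹ r) x y
  add_smul r s x := by
    change α.app g⁻¹ (r + s) • Twist.val x = α.app g⁻¹ r • Twist.val x + α.app g⁻¹ s • Twist.val x
    rw [app_add, add_smul]
  zero_smul x := by
    change α.app g⁻¹ 0 • Twist.val x = 0
    rw [app_zero, zero_smul]

theorem Twist.val_smul (r : R) (x : α.Twist g M hM) :
    Twist.val (r • x) = α.app g⁻¹ r • Twist.val x := rfl

end Twist

theorem e_mul_of_mem_D (g : G) {d : R} (hd : d ∈ α.D g) : α.e g * d = d := by
  obtain ⟨s, rfl⟩ := Ideal.mem_span_singleton'.1 hd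
  linear_combination s * α.e_mul_e g

variable (E : Type*) [AddCommGroup E] [Module R E]

theorem e_smul_tensor (g : G) (x : α.D g ⊗[R] E) : α.e g • x = x := by
  induction x with
  | zero => rw [smul_zero]
  | add x y hx hy => rw [smul_add, hx, hy]
  | tmul d x =>
    rw [TensorProduct.smul_tmul']
    congr 1
    exact Subtype.ext (α.e_mul_of_mem_D g d.2)

/-- `[E]` lies in `PicS(R)^{α*}`: the module `E` represents a class in `PicS(R)` and
`(D_{g⁻¹} ⊗ E)_g ≅ D_g ⊗ E` as `R`-modules for all `g`. -/
def IsInvariant : Prop :=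
  IsPartiallyInvertible R E ∧
    ∀ g : G, Nonempty
      (α.Twist g (α.D g⁻¹ ⊗[R] E) (α.e_smul_tensor E g⁻¹) ≃ₗ[R] α.D g ⊗[R] E)

theorem isPartiallyInvertible_of_invertible [Module.Invertible R E] :
    IsPartiallyInvertible R E := by
  refine ⟨inferInstance, inferInstance, (Algebra.ofId R (Module.End R E)).comp
    (AlgEquiv.toOpposite R R).symm.toAlgHom, ?_⟩
  intro f
  obtain ⟨r, hr⟩ := (Module.Invertible.toModuleEnd_bijective R E).2 f
  exact ⟨MulOpposite.op r, hr⟩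

/-- The ring epimorphism `R → D_g`, `r ↦ r 1_g`. -/
def projHom (g : G) : R →+* (α.idem g).Corner where
  toFun := (α.idem g).toCorner
  map_one' := Subtype.ext (one_mul _)
  map_zero' := Subtype.ext (zero_mul _)
  map_add' _ _ := Subtype.ext (add_mul _ _ _)
  map_mul' r s := Subtype.ext (by
    change r * s * α.e g = r * α.e g * (s * α.e g)
    linear_combination (-(r * s)) * α.e_mul_e g)

/-- The ring epimorphism `R → D_g`, `r ↦ α_g(r 1_{g⁻¹})`. -/
def actHom (g : G) : R →+* (α.idem g).Corner := (α.act g).toRingHom.comp (α.projHom g⁻¹)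

theorem projHom_surjective (g : G) : Function.Surjective (α.projHom g) :=
  fun t => ⟨t.1, toCorner_coe _ t⟩

/-- The ideal `D_g` as an additive group is the ring `D_g`. -/
def idealEquivCorner (g : G) : α.D g ≃+ (α.idem g).Corner where
  toFun d := α.projHom g d.1
  invFun t := ⟨t.1, Ideal.mem_span_singleton'.2 ⟨t.1, corner_mul_e _ t⟩⟩
  left_inv d := Subtype.ext (by
    change d.1 * α.e g = d.1
    rw [mul_comm, α.e_mul_of_mem_D g d.2])
  right_inv t := toCorner_coe _ t
  map_add' _ _ := map_add (α.projHom g) _ _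

theorem exists_addEquiv_mapRingHom {R S : Type u} [CommRing R] [CommRing S] (f : R →+* S)
    (E : Type*) [AddCommGroup E] [Module R E] [Module.Invertible R E] (I : Ideal R) (d : I ≃+ S)
    (hd : ∀ (r : R) (x : I), d (r • x) = f r * d x) :
    ∃ θ : I ⊗[R] E ≃+ (CommRing.Pic.mapRingHom f (CommRing.Pic.mk R E)),
      ∀ (r : R) (t : I ⊗[R] E), θ (r • t) = f r • θ t := by
  let _ : Algebra R S := f.toAlgebra
  let d' : I ≃ₗ[R] S := { d with map_smul' := hd }
  let θ₁ : I ⊗[R] E ≃ₗ[R] S ⊗[R] E := TensorProduct.congr d' (LinearEquiv.refl R E)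
  have h : CommRing.Pic.mk S (S ⊗[R] E) = CommRing.Pic.mapRingHom f (CommRing.Pic.mk R E) := by
    change _ = CommRing.Pic.mk S (S ⊗[R] (CommRing.Pic.mk R E))
    exact CommRing.Pic.mk_eq_mk_iff.2 ⟨TensorProduct.AlgebraTensorModule.congr
      (LinearEquiv.refl S S) (CommRing.Pic.mk.linearEquiv R E).symm⟩
  obtain ⟨θ₂⟩ := CommRing.Pic.mk_eq_iff.1 h
  refine ⟨θ₁.toAddEquiv.trans θ₂.toAddEquiv, fun r t => ?_⟩
  change θ₂ (θ₁ (r • t)) = f r • θ₂ (θ₁ t)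
  rw [map_smul, ← map_smul θ₂]
  congr 1

theorem nonempty_twist_iff (g : G) [Module.Invertible R E] :
    Nonempty (α.Twist g (α.D g⁻¹ ⊗[R] E) (α.e_smul_tensor E g⁻¹) ≃ₗ[R] α.D g ⊗[R] E) ↔
      CommRing.Pic.mapRingHom (α.actHom g) (CommRing.Pic.mk R E)
        = CommRing.Pic.mapRingHom (α.projHom g) (CommRing.Pic.mk R E) := by
  obtain ⟨θ, hθ⟩ := exists_addEquiv_mapRingHom (α.projHom g) E (α.D g) (α.idealEquivCorner g)
    (fun r x => map_mul (α.projHom g) r x.1)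
  obtain ⟨η, hη⟩ := exists_addEquiv_mapRingHom (α.actHom g) E (α.D g⁻¹)
    ((α.idealEquivCorner g⁻¹).trans (α.act g).toAddEquiv)
    (fun r x => map_mul (α.actHom g) r x.1)
  have key : ∀ r, α.actHom g (α.app g⁻¹ r) = α.projHom g r :=
    fun r => Subtype.ext (α.app_app_inv g r)
  rw [CommRing.Pic.ext_iff]
  constructor
  · rintro ⟨φ⟩
    refine ⟨{ η.symm.trans (Twist.val.symm.trans (φ.toAddEquiv.trans θ)) with map_smul' := ?_ }⟩
    intro s x
    obtain ⟨r, rfl⟩ := α.projHom_surjective g s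
    change θ (φ (Twist.val.symm (η.symm (α.projHom g r • x)))) =
      α.projHom g r • θ (φ (Twist.val.symm (η.symm x)))
    rw [← hθ, ← map_smul φ]
    congr 2
    apply Twist.val.injective
    rw [Twist.val_smul, AddEquiv.apply_symm_apply, AddEquiv.apply_symm_apply, AddEquiv.symm_apply_eq,
      hη, key, AddEquiv.apply_symm_apply]
  · rintro ⟨φ⟩
    refine ⟨{ Twist.val.trans (η.trans (φ.toAddEquiv.trans θ.symm)) with map_smul' := ?_ }⟩
    intro r x
    change θ.symm (φ (η (Twist.val (r • x)))) = r • θ.symm (φ (η (Twist.val x)))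
    rw [AddEquiv.symm_apply_eq, hθ, AddEquiv.apply_symm_apply, Twist.val_smul, hη, key, map_smul]

theorem isInvariant_iff [Module.Invertible R E] :
    α.IsInvariant E ↔ ∀ g, CommRing.Pic.mapRingHom (α.actHom g) (CommRing.Pic.mk R E)
        = CommRing.Pic.mapRingHom (α.projHom g) (CommRing.Pic.mk R E) := by
  simp only [IsInvariant, isPartiallyInvertible_of_invertible, true_and, nonempty_twist_iff]

/-- The group `PicS(R)^{α*} ∩ Pic(R)`. -/
def invariantPic : Subgroup (CommRing.Pic R) where
  carrier := {c | α.IsInvariant c.AsModule}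
  one_mem' := by
    simp only [Set.mem_ofPred_eq, isInvariant_iff, CommRing.Pic.mk_eq_self, map_one, implies_true]
  mul_mem' {a b} ha hb := by
    simp only [Set.mem_ofPred_eq, isInvariant_iff, CommRing.Pic.mk_eq_self] at ha hb ⊢
    intro g
    rw [map_mul, map_mul, ha, hb]
  inv_mem' {a} ha := by
    simp only [Set.mem_ofPred_eq, isInvariant_iff, CommRing.Pic.mk_eq_self] at ha ⊢
    intro g
    rw [map_inv, map_inv, ha]

theorem mk_mem_invariantPic_iff [Module.Invertible R E] :
    CommRing.Pic.mk R E ∈ α.invariantPic ↔ α.IsInvariant E := by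
  change α.IsInvariant (CommRing.Pic.mk R E).AsModule ↔ _
  rw [isInvariant_iff, isInvariant_iff, CommRing.Pic.mk_eq_self]

/-! ### The cocycle of a family of isomorphisms -/

/-- The submodule `E D_g` of `E` (identified with `E ⊗ D_g`). -/
def cut (g : G) : Submodule R E := α.D g • ⊤

theorem e_smul_cut (g : G) (x : α.cut E g) : α.e g • x = x := by
  refine Subtype.ext ?_
  obtain ⟨x, hx⟩ := x
  change α.e g • x = x
  refine Submodule.smul_induction_on hx (fun d hd y _ => ?_) (fun y z hy hz => ?_)
  · rw [← mul_smul, α.e_mul_of_mem_D g hd]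
  · rw [smul_add, hy, hz]

/-- Families of `R`-module isomorphisms `ψ_g : E D_g → (E D_{g⁻¹})_g`, `g ∈ G`. -/
abbrev IsoFamily : Type _ :=
  ∀ g : G, α.cut E g ≃ₗ[R] α.Twist g (α.cut E g⁻¹) (α.e_smul_cut E g⁻¹)

variable {α E} in
/-- The value `ψ_g(x)` as an element of `E`. -/
def IsoFamily.val (ψ : α.IsoFamily E) (g : G) (x : α.cut E g) : E := (Twist.val (ψ g x)).1

variable {α E} in
/-- `ω_{g,h} x = ψ_{(gh)⁻¹} ψ_{h⁻¹}⁻¹ ψ_{g⁻¹}⁻¹ (x)` for all `x ∈ E D_g D_{gh}`: the composition is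
defined at `x`, with `y = ψ_{g⁻¹}⁻¹(x)` and `z = ψ_{h⁻¹}⁻¹(y)` (unique since the `ψ` are injective),
and `ψ_{(gh)⁻¹}(z) = ω_{g,h} x`. -/
def Induces (ψ : α.IsoFamily E) (ω : α.C2) : Prop :=
  ∀ (g h : G) (x : E), x ∈ (α.D g * α.D (g * h)) • (⊤ : Submodule R E) →
    ∃ (y : α.cut E g⁻¹) (z : α.cut E h⁻¹) (hz : z.1 ∈ α.cut E (g * h)⁻¹),
      ψ.val g⁻¹ y = x ∧ ψ.val h⁻¹ z = y.1 ∧ ψ.val (g * h)⁻¹ ⟨z.1, hz⟩ = ω.val g h • x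

end

end UnitalPartialAction

/-! Extended by zero, `ψ_{g⁻¹}` becomes an additive endomorphism `Φ_g` of `E` with `Φ_g(r x) = α_g(r
1_{g⁻¹}) Φ_g(x)`, mapping `1_{g⁻¹}E` bijectively onto `1_g E`. All compositions are then defined on
the whole of `E`, and domains are recorded by idempotents. In `Φ_{gh} Φ_h⁻¹ Φ_g⁻¹` the twists
cancel, so this map is `R`-linear. Since `E` is invertible, `End_R(E) = R`, and the map is
multiplication by a scalar, which is a unit of `D_g D_{gh}` (`exists_unit_smul_eq`,
`exists_isFactorSet`). Equivalently, `ω_{g,h} Φ_g Φ_h = 1_g Φ_{gh}`. Expanding `Φ_g Φ_h Φ_l` in two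
ways gives the cocycle identity (`IsFactorSet.mem_Z2`). The same principle applied to `Χ_g Φ_g⁻¹`
shows that two families on `E` differ by a 1-cochain, hence their cocycles differ by a coboundary
(`IsFactorSet.cls_eq`). Transport along `E ≅ F` leaves `ω` unchanged, and tensoring families
multiplies their cocycles (`IsFactorSet.tensor`). This gives independence of the choices and the
homomorphism property. Existence of a family comes from invariance of `E`, through `D_g ⊗ E ≅ 1_g
E`. -/

namespace UnitalPartialAction

/-! ### Semilinear families and their defect -/

section Family

variable {G : Type v} {R : Type u} [Group G] [CommRing R] (α : UnitalPartialAction G R)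

/-- `α_g(α_h(r 1_{h⁻¹}) 1_{g⁻¹}) = α_{gh}(r 1_{(gh)⁻¹}) 1_g`. -/
theorem app_app (g h : G) (r : R) : α.app g (α.app h r) = α.app (g * h) r * α.e g := by
  -- The composition axiom only covers `D_{h⁻¹} D_{(gh)⁻¹}`, so `r` is first cut down to that ideal;
  -- the extra idempotents are absorbed afterwards.
  have h1 := α.act_act g h (r * (α.e h⁻¹ * α.e (g * h)⁻¹))
    ((mem_mul_iff (α.idem _) (α.idem _) _).2 (by
      rw [mul_assoc, ((α.idem h⁻¹).mul (α.idem (g * h)⁻¹)).eq]))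
  change α.app g (α.app h (r * (α.e h⁻¹ * α.e (g * h)⁻¹)))
    = α.app (g * h) (r * (α.e h⁻¹ * α.e (g * h)⁻¹)) at h1
  have hg : h * (g * h)⁻¹ = g⁻¹ := by group
  simp only [app_mul, app_e, hg, mul_inv_cancel, e_one, mul_inv_cancel_right, mul_one] at h1
  have h2 := α.app_mul_e g (α.app h r)
  have h3 : α.app g (α.app h r) * α.e (g * h) = α.app g (α.app h r) := by
    have h4 : α.app g (α.app h r * α.e h) = α.app g (α.app h r) := by rw [app_mul_e]
    rw [app_mul, app_e] at h4
    linear_combination (-α.e (g * h)) * h2 + h4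
  have h4 := α.app_mul_e (g * h) r
  have eg := α.e_mul_e g
  have eh := α.e_mul_e (g * h)
  calc α.app g (α.app h r) = α.app g (α.app h r) * α.e g * α.e (g * h) := by rw [h2, h3]
    _ = α.app (g * h) r * α.e (g * h) * α.e g := by
      linear_combination h1 + (-α.app g (α.app h r) * α.e (g * h) * α.e (g * h) * (α.e g + 1)) * eg
        - α.app g (α.app h r) * α.e g * eh + α.app (g * h) r * α.e g * eh
    _ = _ := by rw [h4]

variable (E : Type*) [AddCommGroup E] [Module R E]

variable {E} in
theorem mem_cut_iff (g : G) (x : E) : x ∈ α.cut E g ↔ α.e g • x = x :=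
  ⟨fun hx => congrArg Subtype.val (α.e_smul_cut E g ⟨x, hx⟩), fun hx => hx ▸
    Submodule.smul_mem_smul (Ideal.mem_span_singleton_self (α.e g)) Submodule.mem_top⟩

variable {E} in
theorem mem_D_mul_D_smul_top_iff (g h : G) (x : E) :
    x ∈ (α.D g * α.D h) • (⊤ : Submodule R E) ↔ (α.e g * α.e h) • x = x := by
  rw [D, D, Ideal.span_singleton_mul_span_singleton]
  refine ⟨fun hx => ?_, fun hx => hx ▸
    Submodule.smul_mem_smul (Ideal.mem_span_singleton_self _) Submodule.mem_top⟩
  rw [Submodule.ideal_span_singleton_smul] at hx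
  obtain ⟨y, -, rfl⟩ := hx
  change (α.e g * α.e h) • (α.e g * α.e h) • y = (α.e g * α.e h) • y
  rw [smul_smul, ((α.idem g).mul (α.idem h)).eq]

/-- Families of mutually inverse semilinear isomorphisms `1_{g⁻¹}E → 1_g E`, both extended by zero
to additive endomorphisms of `E`. -/
structure SemilinearFamily where
  map : G → E →+ E
  inv : G → E →+ E
  map_smul : ∀ g r x, map g (r • x) = α.app g r • map g x
  inv_smul : ∀ g r x, inv g (r • x) = α.app g⁻¹ r • inv g x
  map_inv : ∀ g x, map g (inv g x) = α.e g • x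
  inv_map : ∀ g x, inv g (map g x) = α.e g⁻¹ • x

namespace SemilinearFamily

variable {α E} (Φ : α.SemilinearFamily E)

theorem e_smul_map (g : G) (x : E) : α.e g • Φ.map g x = Φ.map g x := by
  rw [← app_one, ← Φ.map_smul, one_smul]

theorem e_smul_inv (g : G) (x : E) : α.e g⁻¹ • Φ.inv g x = Φ.inv g x := by
  rw [← app_one, ← Φ.inv_smul, one_smul]

/-- The relation `ω_{g,h} Φ_g Φ_h = 1_g Φ_{gh}`. -/
def IsFactorSet (ω : α.C2) : Prop :=
  ∀ g h x, ω.val g h • Φ.map g (Φ.map h x) = α.e g • Φ.map (g * h) x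

/-- The composite `Φ_{gh} Φ_h⁻¹ Φ_g⁻¹`. -/
def defect (g h : G) : E →+ E := (Φ.map (g * h)).comp ((Φ.inv h).comp (Φ.inv g))

theorem defect_apply (g h : G) (x : E) :
    Φ.defect g h x = Φ.map (g * h) (Φ.inv h (Φ.inv g x)) := rfl

/-- The idempotent `1_{h⁻¹}` produced by composing the two partial maps disappears because `Φ_h⁻¹`
takes values in `1_{h⁻¹}E`. -/
theorem inv_inv_smul (g h : G) (r : R) (x : E) :
    Φ.inv h (Φ.inv g (r • x)) = α.app (g * h)⁻¹ r • Φ.inv h (Φ.inv g x) := by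
  rw [Φ.inv_smul, Φ.inv_smul, app_app, mul_smul, e_smul_inv, mul_inv_rev]

theorem map_map_smul (g h : G) (r : R) (x : E) :
    Φ.map g (Φ.map h (r • x)) = α.app (g * h) r • Φ.map g (Φ.map h x) := by
  rw [Φ.map_smul, Φ.map_smul, app_app, mul_smul, e_smul_map]

theorem e_mul_smul_map_map (g h : G) (x : E) :
    (α.e g * α.e (g * h)) • Φ.map g (Φ.map h x) = Φ.map g (Φ.map h x) := by
  rw [← app_e, ← Φ.map_smul, e_smul_map]

theorem map_map_inv_inv (g h : G) (x : E) :
    Φ.map g (Φ.map h (Φ.inv h (Φ.inv g x))) = (α.e g * α.e (g * h)) • x := by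
  rw [Φ.map_inv, Φ.map_smul, app_e, Φ.map_inv, smul_smul]
  congr 1
  linear_combination α.e (g * h) * α.e_mul_e g

theorem inv_inv_map_map (g h : G) (x : E) :
    Φ.inv h (Φ.inv g (Φ.map g (Φ.map h x))) = (α.e h⁻¹ * α.e (g * h)⁻¹) • x := by
  rw [Φ.inv_map, Φ.inv_smul, app_e, Φ.inv_map, smul_smul, mul_inv_rev]
  congr 1
  linear_combination α.e (h⁻¹ * g⁻¹) * α.e_mul_e h⁻¹

/-- Under `α_{gh}` the idempotent of the domain of `Φ_g Φ_h` goes to the idempotent of its range. -/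
theorem app_mul_e_inv (g h : G) :
    α.app (g * h) (α.e h⁻¹ * α.e (g * h)⁻¹) = α.e g * α.e (g * h) := by
  rw [app_mul, app_e, app_e, mul_inv_cancel_right, mul_inv_cancel, e_one]
  linear_combination α.e g * α.e_mul_e (g * h)

theorem e_mul_smul_defect (g h : G) (x : E) :
    (α.e g * α.e (g * h)) • Φ.defect g h x = Φ.defect g h x := by
  have h1 : α.e h⁻¹ • Φ.inv h (Φ.inv g x) = Φ.inv h (Φ.inv g x) := Φ.e_smul_inv h _
  rw [mul_comm, mul_smul, defect_apply, ← h1, Φ.map_smul, app_e, mul_inv_cancel_right, smul_smul,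
    smul_smul]
  congr 1
  linear_combination (α.e (g * h) * α.e (g * h)) * α.e_mul_e g + α.e g * α.e_mul_e (g * h)

/-- The inner inverses twist a scalar by `(gh)⁻¹` and `Φ_{gh}` twists it back; the remaining
`1_{gh}` acts trivially on the range. -/
theorem defect_smul (g h : G) (r : R) (x : E) :
    Φ.defect g h (r • x) = r • Φ.defect g h x := by
  rw [defect_apply, Φ.inv_inv_smul, Φ.map_smul, app_app_inv, mul_smul, e_smul_map, ← defect_apply]

theorem defect_map_map (g h : G) (x : E) :
    Φ.defect g h (Φ.map g (Φ.map h x)) = α.e g • Φ.map (g * h) x := by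
  rw [defect_apply, Φ.inv_inv_map_map, Φ.map_smul, app_mul_e_inv, mul_smul, e_smul_map]

/-- The defect form shows that `ω` comes from linear endomorphisms; the inverse-free form is the
convenient one for the cocycle identity and for tensor products. They are exchanged by substituting
`x ↦ Φ_h⁻¹ Φ_g⁻¹ x` and `x ↦ Φ_g Φ_h x`. -/
theorem isFactorSet_iff (ω : α.C2) :
    Φ.IsFactorSet ω ↔ ∀ g h x, Φ.defect g h x = ω.val g h • x := by
  refine ⟨fun hω g h x => ?_, fun hω g h x => ?_⟩
  · have h1 := hω g h (Φ.inv h (Φ.inv g x))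
    rw [map_map_inv_inv, smul_smul, C2.val_mul_e, ← defect_apply] at h1
    rw [h1, ← e_mul_smul_defect, smul_smul, ← mul_assoc, e_mul_e]
  · rw [← hω, defect_map_map]

/-- The additive endomorphism inverse to the defect. -/
def defectInv (g h : G) : E →+ E := (Φ.map g).comp ((Φ.map h).comp (Φ.inv (g * h)))

theorem defectInv_apply (g h : G) (x : E) :
    Φ.defectInv g h x = Φ.map g (Φ.map h (Φ.inv (g * h) x)) := rfl

theorem defectInv_smul (g h : G) (r : R) (x : E) :
    Φ.defectInv g h (r • x) = r • Φ.defectInv g h x := by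
  rw [defectInv_apply, Φ.inv_smul, Φ.map_map_smul, app_app_inv, defectInv_apply,
    ← Φ.e_mul_smul_map_map, smul_smul, smul_smul]
  congr 1
  linear_combination (r * α.e g) * α.e_mul_e (g * h)

theorem defect_defectInv (g h : G) (x : E) :
    Φ.defect g h (Φ.defectInv g h x) = (α.e g * α.e (g * h)) • x := by
  rw [defectInv_apply, defect_map_map, Φ.map_inv, smul_smul]

end SemilinearFamily

/-! ### Invertible modules: factor sets exist, are unique and are cocycles -/

/-- An invertible linear endomorphism of `eE` is multiplication by a unit of `Re`, when `E` is an
invertible module. -/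
theorem exists_unit_smul_eq [Module.Invertible R E] {e : R} (he : IsIdempotentElem e)
    (F F' : E →+ E) (hF : ∀ (r : R) x, F (r • x) = r • F x)
    (hF' : ∀ (r : R) x, F' (r • x) = r • F' x) (heF : ∀ x, e • F x = F x)
    (hFF' : ∀ x, F (F' x) = e • x) : ∃ u : he.Cornerˣ, ∀ x, F x = u.1.1 • x := by
  obtain ⟨s, hs⟩ := (Module.Invertible.toModuleEnd_bijective R E).2 { F with map_smul' := hF }
  obtain ⟨t, ht⟩ := (Module.Invertible.toModuleEnd_bijective R E).2 { F' with map_smul' := hF' }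
  replace hs (x : E) : s • x = F x := LinearMap.congr_fun hs x
  replace ht (x : E) : t • x = F' x := LinearMap.congr_fun ht x
  have hst : s * t = e := FaithfulSMul.eq_of_smul_eq_smul (α := E) fun x => by
    rw [mul_smul, ht, hs, hFF']
  -- The scalar `t` need not lie in `Re`; projecting both factors to the corner keeps the product
  -- equal to `e`.
  have h1 : he.toCorner s * he.toCorner t = 1 := Subtype.ext (by
    change s * e * (t * e) = e
    linear_combination (e * e) * hst + (e + 1) * he.eq)
  refine ⟨⟨he.toCorner s, he.toCorner t, h1, by rw [mul_comm, h1]⟩, fun x => ?_⟩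
  change F x = (s * e) • x
  rw [mul_comm, mul_smul, hs, heF]

variable {α}

theorem C2.ext_val {w w' : α.C2} (h : ∀ g k, w.val g k = w'.val g k) : w = w' :=
  funext fun g => funext fun k => Units.ext (Subtype.ext (h g k))

namespace SemilinearFamily

variable {E} (Φ : α.SemilinearFamily E)

theorem exists_isFactorSet [Module.Invertible R E] : ∃ ω : α.C2, Φ.IsFactorSet ω := by
  choose ω hω using fun g h => exists_unit_smul_eq E ((α.idem g).mul (α.idem (g * h)))
    (Φ.defect g h) (Φ.defectInv g h) (Φ.defect_smul g h) (Φ.defectInv_smul g h)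
    (Φ.e_mul_smul_defect g h) (Φ.defect_defectInv g h)
  exact ⟨ω, (Φ.isFactorSet_iff ω).2 hω⟩

variable {Φ}

theorem IsFactorSet.unique [Module.Invertible R E] {ω ω' : α.C2} (h : Φ.IsFactorSet ω)
    (h' : Φ.IsFactorSet ω') : ω = ω' :=
  C2.ext_val fun g k => FaithfulSMul.eq_of_smul_eq_smul (α := E) fun x => by
    rw [← (Φ.isFactorSet_iff ω).1 h, ← (Φ.isFactorSet_iff ω').1 h']

/-- Associativity of `Φ_g Φ_h Φ_l` yields the identity on the image of this map. That image is `1_g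
1_{gh} 1_{ghl} E`, both sides of the identity are supported on this idempotent, and `E` is faithful.
-/
theorem IsFactorSet.mem_Z2 [Module.Invertible R E] {ω : α.C2} (hω : Φ.IsFactorSet ω) :
    ω ∈ α.Z2 := fun g h l => by
  have key (x : E) : (α.app g (ω.val h l) * ω.val g (h * l)) • Φ.map g (Φ.map h (Φ.map l x))
      = (ω.val (g * h) l * ω.val g h) • Φ.map g (Φ.map h (Φ.map l x)) := by
    rw [mul_comm, mul_smul, mul_smul, ← Φ.map_smul, hω h l, hω g h, Φ.map_smul,
      smul_comm (ω.val g (h * l)), hω g (h * l), smul_comm (ω.val (g * h) l), hω (g * h) l, app_e,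
      smul_smul, smul_smul, mul_assoc g h l]
    congr 1
    linear_combination α.e (g * h) * α.e_mul_e g
  have hr (y : E) : Φ.map g (Φ.map h (Φ.map l (Φ.inv l (Φ.inv h (Φ.inv g y)))))
      = (α.e g * α.e (g * h) * α.e (g * (h * l))) • y := by
    rw [Φ.map_inv, Φ.map_map_smul, Φ.map_map_inv_inv, app_e, smul_smul, mul_assoc g h l]
    congr 1
    linear_combination (α.e g * α.e (g * (h * l))) * α.e_mul_e (g * h)
  have h1 := C2.val_mul_e α ω g (h * l)
  have h2 := C2.val_mul_e α ω g h
  have h3 := C2.val_mul_e α ω (g * h) l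
  have h4 : α.app g (ω.val h l) * (α.e g * α.e (g * h)) = α.app g (ω.val h l) := by
    rw [← app_e, ← app_mul, ← C2.val_mul_e α ω h l]
    congr 1
    linear_combination (ω.val h l * α.e (h * l)) * α.e_mul_e h
  rw [mul_assoc] at h3
  refine FaithfulSMul.eq_of_smul_eq_smul (α := E) fun y => ?_
  have hk := key (Φ.inv l (Φ.inv h (Φ.inv g y)))
  rw [hr, smul_smul, smul_smul] at hk
  have eg := α.e_mul_e g
  have eh := α.e_mul_e (g * h)
  convert hk using 2
  · calc _ = α.app g (ω.val h l) * (α.e g * α.e (g * h))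
        * (ω.val g (h * l) * (α.e g * α.e (g * (h * l)))) := by rw [h1, h4]
      _ = _ := by
        linear_combination (α.app g (ω.val h l) * α.e (g * h) * ω.val g (h * l)
          * α.e (g * (h * l))) * eg
  · calc _ = ω.val (g * h) l * (α.e (g * h) * α.e (g * (h * l)))
        * (ω.val g h * (α.e g * α.e (g * h))) := by rw [h2, h3]
      _ = _ := by
        linear_combination (ω.val (g * h) l * ω.val g h * α.e g * α.e (g * (h * l))) * eh

/-! ### Change of module and change of family -/

/-- Transport of a semilinear family along a linear equivalence. -/
def congr {F : Type*} [AddCommGroup F] [Module R F] (Φ : α.SemilinearFamily E) (σ : E ≃ₗ[R] F) :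
    α.SemilinearFamily F where
  map g := (σ : E →+ F).comp ((Φ.map g).comp (σ.symm : F →+ E))
  inv g := (σ : E →+ F).comp ((Φ.inv g).comp (σ.symm : F →+ E))
  map_smul g r x := by simp [Φ.map_smul]
  inv_smul g r x := by simp [Φ.inv_smul]
  map_inv g x := by simp [Φ.map_inv]
  inv_map g x := by simp [Φ.inv_map]

theorem IsFactorSet.congr {F : Type*} [AddCommGroup F] [Module R F] {ω : α.C2}
    (hω : Φ.IsFactorSet ω) (σ : E ≃ₗ[R] F) : (Φ.congr σ).IsFactorSet ω := fun g h x => by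
  have h1 := congrArg σ (hω g h (σ.symm x))
  rw [_root_.map_smul, _root_.map_smul] at h1
  simpa [SemilinearFamily.congr] using h1

/-- The map `Χ_g Φ_g⁻¹` is linear and invertible on `1_g E`, with inverse `Φ_g Χ_g⁻¹`, hence it is a
unit `f(g)` of `D_g`. -/
theorem exists_C1 [Module.Invertible R E] (Φ Χ : α.SemilinearFamily E) :
    ∃ f : α.C1, ∀ g x, Χ.map g x = f.val g • Φ.map g x := by
  choose f hf using fun g => exists_unit_smul_eq E (α.idem g)
    ((Χ.map g).comp (Φ.inv g)) ((Φ.map g).comp (Χ.inv g))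
    (fun r x => by
      simp only [AddMonoidHom.comp_apply]
      rw [Φ.inv_smul, Χ.map_smul, app_app_inv, mul_smul, e_smul_map])
    (fun r x => by
      simp only [AddMonoidHom.comp_apply]
      rw [Χ.inv_smul, Φ.map_smul, app_app_inv, mul_smul, e_smul_map])
    (fun x => Χ.e_smul_map g _)
    (fun x => by
      simp only [AddMonoidHom.comp_apply]
      rw [Φ.inv_map, Χ.map_smul, app_e, mul_inv_cancel, e_one, mul_one, Χ.map_inv, smul_smul,
        e_mul_e])
  refine ⟨f, fun g x => ?_⟩
  have h := hf g (Φ.map g x)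
  simp only [AddMonoidHom.comp_apply] at h
  rw [Φ.inv_map, Χ.map_smul, app_e, mul_inv_cancel, e_one, mul_one, e_smul_map] at h
  exact h

/-- Substituting `Χ = f Φ` into the relation for `ω'` gives `ω'_{g,h} α_g(f(h)) f(g) = f(gh)
ω_{g,h}`, so `ω` is `ω'` times the coboundary of `f`. -/
theorem IsFactorSet.cls_eq [Module.Invertible R E] {Φ Χ : α.SemilinearFamily E} {ω ω' : α.Z2}
    (hω : Φ.IsFactorSet ω.1) (hω' : Χ.IsFactorSet ω'.1) : cls ω = cls ω' := by
  obtain ⟨f, hf⟩ := exists_C1 Φ Χ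
  refine (QuotientGroup.eq.2 ?_).symm
  refine Subgroup.mem_subgroupOf.2 ⟨f, fun g h => ?_⟩
  have key (x : E) : (ω'.1.val g h * (α.app g (f.val h) * f.val g)) • Φ.map g (Φ.map h x)
      = (f.val (g * h) * ω.1.val g h) • Φ.map g (Φ.map h x) := by
    have h1 := hω' g h x
    rw [hf, hf, hf, Φ.map_smul, smul_comm _ (f.val (g * h)), ← hω g h] at h1
    rw [mul_smul, mul_comm (α.app g (f.val h)), mul_smul, h1, ← mul_smul]
  -- `Φ_g Φ_h` can be cancelled: its image is `1_g 1_{gh} E`, where both cocycles are supported.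
  have key2 : ω'.1.val g h * (α.app g (f.val h) * f.val g) = f.val (g * h) * ω.1.val g h := by
    refine FaithfulSMul.eq_of_smul_eq_smul (α := E) fun y => ?_
    have hk := key (Φ.inv h (Φ.inv g y))
    rw [Φ.map_map_inv_inv, smul_smul, smul_smul] at hk
    convert hk using 2
    · linear_combination (-(α.app g (f.val h) * f.val g)) * C2.val_mul_e α ω'.1 g h
    · linear_combination (-f.val (g * h)) * C2.val_mul_e α ω.1 g h
  change (ω'⁻¹ * ω).1.val g h = _
  change (ω'.1⁻¹).val g h * ω.1.val g h = _
  have h1 := C2.val_mul_inv α ω'.1 g h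
  have h2 := C1.val_mul_inv α f (g * h)
  have h3 := C2.val_mul_e α ω.1 g h
  have h4 := C1.val_mul_e α f⁻¹ (g * h)
  have h5 := C1.val_mul_e α f g
  have eh := α.e_mul_e (g * h)
  calc _ = (ω'.1⁻¹).val g h * (ω.1.val g h * (α.e g * α.e (g * h))) * α.e (g * h) := by
        rw [h3]
        linear_combination (-(ω'.1⁻¹).val g h) * h3
          + (ω'.1⁻¹).val g h * α.e (g * h) * h3
          - (ω'.1⁻¹).val g h * ω.1.val g h * α.e g * eh
    _ = (ω'.1⁻¹).val g h * (f.val (g * h) * ω.1.val g h) * f⁻¹.val (g * h) := by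
        rw [h3]
        linear_combination (-(ω'.1⁻¹).val g h * ω.1.val g h) * h2
    _ = (α.e g * α.e (g * h)) * (α.app g (f.val h) * f.val g) * f⁻¹.val (g * h) := by
        rw [← key2, ← h1]
        ring
    _ = _ := by
        linear_combination (α.e g * α.app g (f.val h) * f.val g) * h4
          + (α.app g (f.val h) * f⁻¹.val (g * h)) * h5

/-! ### Tensor products of families -/

/-- The tensor product of two semilinear additive maps. -/
noncomputable def tensorMap {F : Type*} [AddCommGroup F] [Module R F] (g : G) (f : E →+ E)
    (f' : F →+ F) (hf : ∀ (r : R) x, f (r • x) = α.app g r • f x)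
    (hf' : ∀ (r : R) x, f' (r • x) = α.app g r • f' x) : E ⊗[R] F →+ E ⊗[R] F :=
  -- The factors are not `R`-linear, so the map is lifted from a biadditive one; it is balanced
  -- because a scalar `r` leaves either factor as `α_g(r 1_{g⁻¹})`.
  TensorProduct.liftAddHom
    (AddMonoidHom.mk' (fun x => AddMonoidHom.mk' (fun y => f x ⊗ₜ[R] f' y)
      fun y z => by rw [map_add, TensorProduct.tmul_add])
      fun x y => AddMonoidHom.ext fun z => by
        simp [TensorProduct.add_tmul])
    fun r x y => by
      simp [hf, hf', TensorProduct.smul_tmul]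

theorem tensorMap_smul {F : Type*} [AddCommGroup F] [Module R F] (g : G) (f : E →+ E)
    (f' : F →+ F) (hf : ∀ (r : R) x, f (r • x) = α.app g r • f x)
    (hf' : ∀ (r : R) x, f' (r • x) = α.app g r • f' x) (r : R) (t : E ⊗[R] F) :
    tensorMap g f f' hf hf' (r • t) = α.app g r • tensorMap g f f' hf hf' t := by
  induction t with
  | zero => simp
  | add x y hx hy => rw [smul_add, map_add, hx, hy, map_add, smul_add]
  | tmul x y =>
    change f (r • x) ⊗ₜ[R] f' y = _ • (f x ⊗ₜ[R] f' y)
    rw [hf, TensorProduct.smul_tmul']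

theorem e_smul_tmul_e_smul {F : Type*} [AddCommGroup F] [Module R F] (g : G) (x : E) (y : F) :
    (α.e g • x) ⊗ₜ[R] (α.e g • y) = α.e g • (x ⊗ₜ[R] y) := by
  rw [TensorProduct.tmul_smul, TensorProduct.smul_tmul', smul_smul, e_mul_e,
    TensorProduct.smul_tmul']

/-- The tensor product of two semilinear families. -/
noncomputable def tensor {F : Type*} [AddCommGroup F] [Module R F] (Φ : α.SemilinearFamily E)
    (Χ : α.SemilinearFamily F) : α.SemilinearFamily (E ⊗[R] F) where
  map g := tensorMap g (Φ.map g) (Χ.map g) (Φ.map_smul g) (Χ.map_smul g)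
  inv g := tensorMap g⁻¹ (Φ.inv g) (Χ.inv g) (Φ.inv_smul g) (Χ.inv_smul g)
  map_smul g := tensorMap_smul g _ _ _ _
  inv_smul g := tensorMap_smul g⁻¹ _ _ _ _
  map_inv g t := by
    induction t with
    | zero => simp
    | add x y hx hy => rw [map_add, map_add, hx, hy, smul_add]
    | tmul x y =>
      change Φ.map g (Φ.inv g x) ⊗ₜ[R] Χ.map g (Χ.inv g y) = _
      rw [Φ.map_inv, Χ.map_inv, e_smul_tmul_e_smul]
  inv_map g t := by
    induction t with
    | zero => simp
    | add x y hx hy => rw [map_add, map_add, hx, hy, smul_add]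
    | tmul x y =>
      change Φ.inv g (Φ.map g x) ⊗ₜ[R] Χ.inv g (Χ.map g y) = _
      rw [Φ.inv_map, Χ.inv_map, e_smul_tmul_e_smul]

theorem IsFactorSet.tensor {F : Type*} [AddCommGroup F] [Module R F] {Φ : α.SemilinearFamily E}
    {Χ : α.SemilinearFamily F} {ω ω' : α.C2} (hω : Φ.IsFactorSet ω) (hω' : Χ.IsFactorSet ω') :
    (Φ.tensor Χ).IsFactorSet (ω * ω') := fun g h t => by
  induction t with
  | zero => simp
  | add x y hx hy => simp only [map_add, smul_add, hx, hy]
  | tmul x y =>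
    change _ • (Φ.map g (Φ.map h x) ⊗ₜ[R] Χ.map g (Χ.map h y))
      = _ • (Φ.map (g * h) x ⊗ₜ[R] Χ.map (g * h) y)
    rw [C2.val_mul, mul_smul, ← TensorProduct.tmul_smul, TensorProduct.smul_tmul', hω g h, hω' g h,
      e_smul_tmul_e_smul]

end SemilinearFamily

end Family

end UnitalPartialAction

namespace UnitalPartialAction

/-! ### Dictionary between families `ψ` and semilinear families -/

section IsoFamily

variable {G : Type v} {R : Type u} [Group G] [CommRing R] {α : UnitalPartialAction G R}
  {E : Type*} [AddCommGroup E] [Module R E]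

theorem IsoFamily.val_smul (ψ : α.IsoFamily E) (g : G) (r : R) (x : α.cut E g) :
    ψ.val g (r • x) = α.app g⁻¹ r • ψ.val g x := by
  rw [IsoFamily.val, map_smul, Twist.val_smul]
  rfl

theorem IsoFamily.val_add (ψ : α.IsoFamily E) (g : G) (x y : α.cut E g) :
    ψ.val g (x + y) = ψ.val g x + ψ.val g y := by
  rw [IsoFamily.val, map_add, map_add]
  rfl

/-- The inverse of `ψ_g`, as a map from `E D_{g⁻¹}` to `E`. -/
def IsoFamily.inv (ψ : α.IsoFamily E) (g : G) (y : α.cut E g⁻¹) : E :=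
  ((ψ g).symm (Twist.val.symm y)).1

theorem IsoFamily.inv_smul (ψ : α.IsoFamily E) (g : G) (r : R) (y : α.cut E g⁻¹) :
    ψ.inv g (r • y) = α.app g r • ψ.inv g y := by
  have h : Twist.val.symm (r • y)
      = α.app g r • (Twist.val.symm y : α.Twist g (α.cut E g⁻¹) (α.e_smul_cut E g⁻¹)) := by
    apply Twist.val.injective
    rw [Twist.val_smul, AddEquiv.apply_symm_apply, AddEquiv.apply_symm_apply]
    have := α.app_app_inv g⁻¹ r
    rw [inv_inv] at this
    rw [this, mul_smul, e_smul_cut]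
  rw [IsoFamily.inv, h, map_smul]
  rfl

theorem IsoFamily.inv_add (ψ : α.IsoFamily E) (g : G) (x y : α.cut E g⁻¹) :
    ψ.inv g (x + y) = ψ.inv g x + ψ.inv g y := by
  rw [IsoFamily.inv, map_add, map_add]
  rfl

/-- The element `1_g x` of `E D_g`. -/
def toCut (α : UnitalPartialAction G R) (g : G) : E →ₗ[R] α.cut E g :=
  (LinearMap.lsmul R E (α.e g)).codRestrict _ fun x => (α.mem_cut_iff g _).2 (by
    rw [LinearMap.lsmul_apply, smul_smul, e_mul_e])

theorem toCut_coe (g : G) (x : E) : (α.toCut g x).1 = α.e g • x := rfl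

theorem toCut_of_mem (g : G) (x : α.cut E g) : α.toCut g x.1 = x :=
  Subtype.ext (congrArg Subtype.val (α.e_smul_cut E g x))

/-- The semilinear family `Φ_g = ψ_{g⁻¹}` of a family of isomorphisms `ψ`. -/
def IsoFamily.toSemilinear (ψ : α.IsoFamily E) : α.SemilinearFamily E where
  map g := AddMonoidHom.mk' (fun x => ψ.val g⁻¹ (α.toCut g⁻¹ x)) fun x y => by
    rw [map_add, ψ.val_add]
  inv g := AddMonoidHom.mk' (fun x => ψ.inv g⁻¹ (α.toCut g⁻¹⁻¹ x)) fun x y => by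
    rw [map_add, ψ.inv_add]
  map_smul g r x := by
    simp only [AddMonoidHom.mk'_apply]
    rw [map_smul, ψ.val_smul, inv_inv]
  inv_smul g r x := by
    simp only [AddMonoidHom.mk'_apply]
    rw [map_smul, ψ.inv_smul]
  map_inv g x := by
    simp only [AddMonoidHom.mk'_apply, IsoFamily.inv, IsoFamily.val]
    rw [toCut_of_mem, LinearEquiv.apply_symm_apply, AddEquiv.apply_symm_apply, toCut_coe, inv_inv]
  inv_map g x := by
    simp only [AddMonoidHom.mk'_apply, IsoFamily.inv, IsoFamily.val]
    rw [toCut_of_mem, AddEquiv.symm_apply_apply, LinearEquiv.symm_apply_apply, toCut_coe]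

theorem IsoFamily.toSemilinear_map_coe (ψ : α.IsoFamily E) (g : G) (x : α.cut E g⁻¹) :
    ψ.toSemilinear.map g x.1 = ψ.val g⁻¹ x := by
  change ψ.val g⁻¹ (α.toCut g⁻¹ x.1) = _
  rw [toCut_of_mem]

/-- Injectivity forces the intermediate points to be `Φ_g⁻¹ x` and `Φ_h⁻¹ Φ_g⁻¹ x`. Conversely these
points lie in the required submodules when `x ∈ E D_g D_{gh}`, so the composition is defined there.
-/
theorem induces_iff (ψ : α.IsoFamily E) (ω : α.C2) :
    Induces ψ ω ↔ ψ.toSemilinear.IsFactorSet ω := by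
  rw [SemilinearFamily.isFactorSet_iff]
  set Φ := ψ.toSemilinear with hΦ
  have e_inv (g : G) {x : E} (hx : x ∈ α.cut E g⁻¹) : Φ.inv g (Φ.map g x) = x := by
    rw [Φ.inv_map, (α.mem_cut_iff _ _).1 hx]
  refine ⟨fun H g h x => ?_, fun H g h x hx => ?_⟩
  -- An arbitrary `x` is projected to `E D_g D_{gh}`; neither the defect nor `ω_{g,h}` sees the
  -- difference.
  · obtain ⟨y, z, hz, hy, hzy, hx⟩ := H g h ((α.e g * α.e (g * h)) • x)
      ((α.mem_D_mul_D_smul_top_iff _ _ _).2 (by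
        rw [smul_smul, ((α.idem g).mul (α.idem (g * h))).eq]))
    rw [← ψ.toSemilinear_map_coe, ← hΦ] at hy hzy hx
    rw [← Φ.e_mul_smul_defect, ← Φ.defect_smul, ← hy, Φ.defect_apply, e_inv g y.2, ← hzy,
      e_inv h z.2, hx, smul_smul, C2.val_mul_e]
  · rw [mem_D_mul_D_smul_top_iff] at hx
    have h1 : α.e (g * h) • x = x := by
      conv_rhs => rw [← hx]
      conv_lhs => rw [← hx]
      rw [smul_smul]
      congr 1
      linear_combination α.e g * α.e_mul_e (g * h)
    have h2 : α.e g • x = x := by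
      conv_rhs => rw [← hx]
      conv_lhs => rw [← hx]
      rw [smul_smul]
      congr 1
      linear_combination α.e (g * h) * α.e_mul_e g
    have hz : Φ.inv h (Φ.inv g x) ∈ α.cut E (g * h)⁻¹ := by
      rw [mem_cut_iff]
      conv_rhs => rw [← h1, Φ.inv_inv_smul, app_e, inv_mul_cancel, e_one, mul_one]
    have h3 : α.e h • Φ.inv g x = Φ.inv g x := by
      have h4 : Φ.inv g (α.e (g * h) • x) = Φ.inv g x := by rw [h1]
      rwa [Φ.inv_smul, app_e, inv_mul_cancel_left, mul_comm, mul_smul, Φ.e_smul_inv] at h4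
    refine ⟨⟨Φ.inv g x, (α.mem_cut_iff _ _).2 (Φ.e_smul_inv g x)⟩,
      ⟨Φ.inv h (Φ.inv g x), (α.mem_cut_iff _ _).2 (Φ.e_smul_inv h _)⟩, hz, ?_, ?_, ?_⟩
    · rw [← ψ.toSemilinear_map_coe, ← hΦ, Φ.map_inv, h2]
    · rw [← ψ.toSemilinear_map_coe, ← hΦ, Φ.map_inv, h3]
    · rw [← ψ.toSemilinear_map_coe, ← hΦ, ← Φ.defect_apply, H]

/-- The family of isomorphisms `ψ_g = Φ_{g⁻¹}` of a semilinear family `Φ`. -/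
def SemilinearFamily.toIsoFamily (Φ : α.SemilinearFamily E) : α.IsoFamily E := fun g =>
  { toFun := fun x => Twist.val.symm
      ⟨Φ.map g⁻¹ x.1, (α.mem_cut_iff _ _).2 (Φ.e_smul_map g⁻¹ _)⟩
    invFun := fun y => ⟨Φ.inv g⁻¹ (Twist.val y).1, (α.mem_cut_iff _ _).2 (by
      have h := Φ.e_smul_inv g⁻¹ (Twist.val y).1
      rwa [inv_inv] at h)⟩
    map_add' := fun x y => by
      apply Twist.val.injective
      rw [map_add]
      simp only [AddEquiv.apply_symm_apply]
      exact Subtype.ext (map_add (Φ.map g⁻¹) x.1 y.1)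
    map_smul' := fun r x => by
      apply Twist.val.injective
      rw [RingHom.id_apply, Twist.val_smul]
      simp only [AddEquiv.apply_symm_apply]
      exact Subtype.ext (Φ.map_smul g⁻¹ r x.1)
    left_inv := fun x => Subtype.ext (by
      simp only [AddEquiv.apply_symm_apply]
      rw [Φ.inv_map, inv_inv]
      exact (α.mem_cut_iff _ _).1 x.2)
    right_inv := fun y => by
      apply Twist.val.injective
      simp only [AddEquiv.apply_symm_apply]
      refine Subtype.ext ?_
      simp only [Φ.map_inv]
      exact (α.mem_cut_iff _ _).1 (Twist.val y).2 }

/-! ### Invariance yields a semilinear family -/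

/-- The map `x ↦ 1_g ⊗ x` from `E` to `D_g ⊗ E`. -/
noncomputable def toDTensor (α : UnitalPartialAction G R) (g : G) : E →ₗ[R] α.D g ⊗[R] E :=
  TensorProduct.mk R (α.D g) E ⟨α.e g, Ideal.mem_span_singleton_self _⟩

/-- The map `d ⊗ x ↦ d x` from `D_g ⊗ E` to `E`. -/
noncomputable def ofDTensor (α : UnitalPartialAction G R) (g : G) : α.D g ⊗[R] E →ₗ[R] E :=
  TensorProduct.lift ((LinearMap.lsmul R E).comp (α.D g).subtype)

theorem ofDTensor_toDTensor (g : G) (x : E) : α.ofDTensor g (α.toDTensor g x) = α.e g • x := rfl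

theorem toDTensor_ofDTensor (g : G) (t : α.D g ⊗[R] E) : α.toDTensor g (α.ofDTensor g t) = t := by
  induction t with
  | zero => simp
  | add x y hx hy => rw [map_add, map_add, hx, hy]
  | tmul d x =>
    change (⟨α.e g, _⟩ : α.D g) ⊗ₜ[R] (d.1 • x) = d ⊗ₜ[R] x
    rw [← TensorProduct.smul_tmul]
    congr 1
    exact Subtype.ext ((mul_comm _ _).trans (α.e_mul_of_mem_D g d.2))

theorem IsInvariant.nonempty_semilinearFamily (h : α.IsInvariant E) :
    Nonempty (α.SemilinearFamily E) := by
  let T := fun g => (h.2 g).some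
  -- In the twisted module `α_g(r 1_{g⁻¹})` acts as `r 1_{g⁻¹}`, that is, as `r`; so linearity of `T
  -- g` on the twist is `α_g`-semilinearity on `D_{g⁻¹} ⊗ E`.
  have hT (g : G) (r : R) (t : α.D g⁻¹ ⊗[R] E) :
      T g (Twist.val.symm (r • t)) = α.app g r • T g (Twist.val.symm t) := by
    rw [← map_smul]
    congr 1
    apply Twist.val.injective
    rw [Twist.val_smul, AddEquiv.apply_symm_apply, AddEquiv.apply_symm_apply]
    have := α.app_app_inv g⁻¹ r
    rw [inv_inv] at this
    rw [this, mul_smul, e_smul_tensor]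
  exact ⟨{
    map := fun g => AddMonoidHom.mk'
      (fun x => α.ofDTensor g (T g (Twist.val.symm (α.toDTensor g⁻¹ x))))
      fun x y => by simp only [map_add]
    inv := fun g => AddMonoidHom.mk'
      (fun x => α.ofDTensor g⁻¹ (Twist.val ((T g).symm (α.toDTensor g x))))
      fun x y => by simp only [map_add]
    map_smul := fun g r x => by
      simp only [AddMonoidHom.mk'_apply]
      rw [map_smul, hT, map_smul]
    inv_smul := fun g r x => by
      simp only [AddMonoidHom.mk'_apply]
      rw [map_smul, map_smul, Twist.val_smul, map_smul]
    map_inv := fun g x => by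
      simp only [AddMonoidHom.mk'_apply]
      rw [toDTensor_ofDTensor, AddEquiv.symm_apply_apply, LinearEquiv.apply_symm_apply,
        ofDTensor_toDTensor]
    inv_map := fun g x => by
      simp only [AddMonoidHom.mk'_apply]
      rw [toDTensor_ofDTensor, LinearEquiv.symm_apply_apply, AddEquiv.apply_symm_apply,
        ofDTensor_toDTensor] }⟩

/-! ### The homomorphism into `H²` -/

theorem exists_semilinearFamily_of_mem_invariantPic (c : CommRing.Pic R)
    (hc : c ∈ α.invariantPic) :
    ∃ (Φ : α.SemilinearFamily c.AsModule) (ω : α.Z2), Φ.IsFactorSet ω.1 := by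
  obtain ⟨Φ⟩ := IsInvariant.nonempty_semilinearFamily hc
  obtain ⟨ω, hω⟩ := Φ.exists_isFactorSet
  exact ⟨Φ, ⟨ω, hω.mem_Z2⟩, hω⟩

theorem exists_unique_monoidHom_invariantPic (α : UnitalPartialAction G R) :
    ∃! φ : α.invariantPic →* α.H2,
      ∀ (E : Type u) [AddCommGroup E] [Module R E] [Module.Invertible R E]
        (hE : CommRing.Pic.mk R E ∈ α.invariantPic) (ψ : α.IsoFamily E) (ω : α.Z2),
        Induces ψ ω.1 → φ ⟨CommRing.Pic.mk R E, hE⟩ = cls ω := by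
  choose Φ ω hω using fun c : α.invariantPic =>
    exists_semilinearFamily_of_mem_invariantPic c.1 c.2
  have hmul (a b : α.invariantPic) : cls (ω (a * b)) = cls (ω a) * cls (ω b) := by
    have h : CommRing.Pic.mk R (a.1.AsModule ⊗[R] b.1.AsModule)
        = CommRing.Pic.mk R (a * b).1.AsModule := by
      rw [CommRing.Pic.mk_tensor, CommRing.Pic.mk_eq_self, CommRing.Pic.mk_eq_self,
        CommRing.Pic.mk_eq_self]
      rfl
    obtain ⟨σ⟩ := CommRing.Pic.mk_eq_mk_iff.1 h
    -- Two families on the same representative of `a * b` are compared: the chosen one, and the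
    -- transported tensor product of those chosen for `a` and `b`.
    exact SemilinearFamily.IsFactorSet.cls_eq (ω' := ω a * ω b) (hω (a * b))
      (((hω a).tensor (hω b)).congr σ)
  refine ⟨MonoidHom.mk' (fun c => cls (ω c)) hmul, ?_, fun φ hφ => MonoidHom.ext fun c => ?_⟩
  · intro E _ _ _ hE ψ ω' hω'
    exact ((hω ⟨CommRing.Pic.mk R E, hE⟩).congr (CommRing.Pic.mk.linearEquiv R E)).cls_eq
      ((induces_iff ψ ω'.1).1 hω')
  · have hc : CommRing.Pic.mk R c.1.AsModule ∈ α.invariantPic := by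
      rw [CommRing.Pic.mk_eq_self]
      exact c.2
    -- The round trip through `IsoFamily` need not be identified with `Φ c`: any two families on the
    -- module give the same class.
    obtain ⟨ω', hω'⟩ := (Φ c).toIsoFamily.toSemilinear.exists_isFactorSet
    have h1 := hφ c.1.AsModule hc (Φ c).toIsoFamily ⟨ω', hω'.mem_Z2⟩ ((induces_iff _ _).2 hω')
    have h2 : (⟨CommRing.Pic.mk R c.1.AsModule, hc⟩ : α.invariantPic) = c :=
      Subtype.ext CommRing.Pic.mk_eq_self
    rw [h2] at h1
    rw [h1]
    exact SemilinearFamily.IsFactorSet.cls_eq (ω := ⟨ω', hω'.mem_Z2⟩) hω' (hω c)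

end IsoFamily

end UnitalPartialAction
theorem mainTheorem5 {G : Type v} [Group G] [Finite G] {R : Type u} [CommRing R]
    (α : UnitalPartialAction G R) (hα : α.IsPartialGalois) :
    (∀ (E : Type u) [AddCommGroup E] [Module R E] [Module.Invertible R E],
      CommRing.Pic.mk R E ∈ α.invariantPic →
        Nonempty (α.IsoFamily E) ∧
        ∀ ψ : α.IsoFamily E, ∃ ω : α.Z2,
          UnitalPartialAction.Induces ψ ω.1 ∧
            ∀ ω' : α.C2, UnitalPartialAction.Induces ψ ω' → ω' = ω.1) ∧
    (∀ (E F : Type u) [AddCommGroup E] [Module R E] [Module.Invertible R E]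
        [AddCommGroup F] [Module R F] [Module.Invertible R F],
      CommRing.Pic.mk R E ∈ α.invariantPic → Nonempty (E ≃ₗ[R] F) →
        ∀ (ψ : α.IsoFamily E) (χ : α.IsoFamily F) (ω ω' : α.Z2),
          UnitalPartialAction.Induces ψ ω.1 → UnitalPartialAction.Induces χ ω'.1 →
            UnitalPartialAction.cls ω = UnitalPartialAction.cls ω') ∧
    ∃! φ : α.invariantPic →* α.H2,
      ∀ (E : Type u) [AddCommGroup E] [Module R E] [Module.Invertible R E]
        (hE : CommRing.Pic.mk R E ∈ α.invariantPic) (ψ : α.IsoFamily E) (ω : α.Z2),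
        UnitalPartialAction.Induces ψ ω.1 →
          φ ⟨CommRing.Pic.mk R E, hE⟩ = UnitalPartialAction.cls ω := by
  refine ⟨fun E _ _ _ hE => ?_, fun E F _ _ _ _ _ _ _ ⟨σ⟩ ψ χ ω ω' hω hω' => ?_,
    α.exists_unique_monoidHom_invariantPic⟩
  · obtain ⟨Φ⟩ := ((α.mk_mem_invariantPic_iff E).1 hE).nonempty_semilinearFamily
    refine ⟨⟨Φ.toIsoFamily⟩, fun ψ => ?_⟩
    obtain ⟨ω, hω⟩ := ψ.toSemilinear.exists_isFactorSet
    exact ⟨⟨ω, hω.mem_Z2⟩, (UnitalPartialAction.induces_iff ψ ω).2 hω,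
      fun ω' hω' => ((UnitalPartialAction.induces_iff ψ ω').1 hω').unique hω⟩
  · exact (((UnitalPartialAction.induces_iff ψ ω.1).1 hω).congr σ).cls_eq
      ((UnitalPartialAction.induces_iff χ ω'.1).1 hω')
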